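/- Let $K$ be a perfect field of characteristic $p>0$, let $A=K[x_1,\dots,x_n]$ and $\mathfrak m_A=(x_1,\dots,x_n)A$. "Monomial" means $x_1^{h_1}\cdots x_n^{h_n}$ with $h_i\in\mathbb N$. A semigroup $S$ of monomials (containing $1$) is *full* if whenever $ab=c$ for monomials $a,b,c$ with $b,c\in S$, then $a\in S$. Let $R=K[S]\subseteq A$ be the subring generated over $K$ by a full semigroup $S$ of monomials, and assume that for each $1\le i\le n$ there is a monomial $a_i\in A$ not involving $x_i$ with $a_i/x_i=\mu_i/\eta_i$ for monomials $\mu_i,\eta_i\in R$. Let $\mu_0\in R$ be a monomial in which every $x_i$ occurs with positive exponent, and put $\mu=\mu_0\mu_1\cdots\mu_n$. For $t\ge 1$ let $\mathfrak a_t$ be the ideal of $R$ generated by the monomials in $R$ that do not divide $\mu^t$ in $R$. For an ideal $I$ let $I^{[q]}$ be the ideal generated by the $q$-th powers of the elements of $I$, and let $\ell$ denote length as an $R$-module. Let $R$ be graded by total degree, with homogeneous maximal ideal $\mathfrak m$ (the elements of $R$ with zero constant term), and let $R^{1/q}$ be the ring of $q$-th roots of elements of $R$ in an algebraic closure of $\operatorname{Frac}(R)$.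 A module over a ring $B$ "has no free summand" if no direct summand of it is isomorphic to $B$. Then for every $q=p^e$ ($e\ge 0$) and every integer $t\ge 1$: 1. $\mathfrak a_t^{[q]}:_R\mu^{tq}=\mathfrak m_A^{[q]}\cap R$. 2. If $R^{1/q}\cong R^{a_q}\oplus M_q$ as $R$-modules, where $M_q$ has no free summand and admits a $\mathbb Q$-grading making it a graded $R$-module, then $$a_q=\ell\left(\frac{R}{\mathfrak a_t^{[q]}:_R\mu^{tq}}\right)=\ell\left(\frac{R}{\mathfrak m_A^{[q]}\cap R}\right).$$ 3. The same formula holds if $(R^{1/q})_{\mathfrak m}\cong (R_{\mathfrak m})^{a_q}\oplus M_q$ as $R_{\mathfrak m}$-modules, where the $R_{\mathfrak m}$-module $M_q$ has no free summand. -/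

import Mathlib

open MvPolynomial

/-- A semigroup of monomials, identified with a subsemigroup (containing `0`) of `ℕⁿ`, is full
if for monomials `a`, `b`, `c` with `ab = c` and `b, c` in the semigroup, also `a` is in it. -/
def IsFull {n : ℕ} (S : AddSubmonoid (Fin n →₀ ℕ)) : Prop :=
  ∀ a b : Fin n →₀ ℕ, b ∈ S → a + b ∈ S → a ∈ S

/-- The subring `R = K[S]` of `K[x₁, …, xₙ]` generated, as a `K`-algebra, by the monomials
with exponents in `S`. -/
noncomputable def monomialSubring (K : Type*) [Field K] {n : ℕ}
    (S : AddSubmonoid (Fin n →₀ ℕ)) : Subalgebra K (MvPolynomial (Fin n) K) :=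
  Algebra.adjoin K ((fun d => monomial d (1 : K)) '' (S : Set (Fin n →₀ ℕ)))

instance monomialSubring.charP (K : Type*) [Field K] {n : ℕ}
    (S : AddSubmonoid (Fin n →₀ ℕ)) (p : ℕ) [CharP K p] : CharP (monomialSubring K S) p :=
  charP_of_injective_algebraMap (algebraMap K (monomialSubring K S)).injective p

/-- A monomial (with coefficient `1`) of the polynomial ring. -/
def IsMonomial {K : Type*} [Field K] {n : ℕ} (f : MvPolynomial (Fin n) K) : Prop :=
  ∃ d : Fin n →₀ ℕ, f = monomial d 1

/-- The ideal `I^[q]`, generated by the `q`-th powers of the elements of `I`. -/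
def bracketPower {B : Type*} [CommRing B] (I : Ideal B) (q : ℕ) : Ideal B :=
  Ideal.span ((fun x => x ^ q) '' (I : Set B))

/-- The ideal of `R` generated by the monomials in `R` that do not divide (in `R`) the element
`ν` of `R`. -/
noncomputable def nonDivisorIdeal {K : Type*} [Field K] {n : ℕ} (R : Subalgebra K (MvPolynomial (Fin n) K))
    (ν : R) : Ideal R :=
  Ideal.span {r : R | IsMonomial (r : MvPolynomial (Fin n) K) ∧ ¬ r ∣ ν}

/-- The maximal ideal `(x₁, …, xₙ)` of the polynomial ring `A = K[x₁, …, xₙ]`. -/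
noncomputable def varIdeal (K : Type*) [Field K] (n : ℕ) : Ideal (MvPolynomial (Fin n) K) :=
  Ideal.span (Set.range X)

/-- The length `ℓ(B/I)` of the `B`-module `B/I`. -/
noncomputable def colength {B : Type*} [CommRing B] (I : Ideal B) : ℕ∞ :=
  Module.length B (B ⧸ I)

/-- The homogeneous maximal ideal of `R`: the elements of `R` with zero constant term. -/
noncomputable abbrev homMaxIdeal {K : Type*} [Field K] {n : ℕ}
    (R : Subalgebra K (MvPolynomial (Fin n) K)) : Ideal R :=
  RingHom.ker ((constantCoeff (R := K) (σ := Fin n)).comp R.val.toRingHom)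

instance homMaxIdeal.isPrime {K : Type*} [Field K] {n : ℕ}
    (R : Subalgebra K (MvPolynomial (Fin n) K)) : (homMaxIdeal R).IsPrime :=
  RingHom.ker_isPrime _

/-- For a domain `B` of prime characteristic `p` and `q = p ^ e`, the ring `B^{1/q}` of `q`-th
roots of elements of `B`, inside an algebraic closure of the fraction field of `B`. -/
noncomputable def rootRing (B : Type*) [CommRing B] [IsDomain B] (p : ℕ) [Fact p.Prime] [CharP B p] (e : ℕ) :
    Subalgebra B (AlgebraicClosure (FractionRing B)) where
  carrier := {z | ∃ b : B, z ^ p ^ e = algebraMap B (AlgebraicClosure (FractionRing B)) b}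
  mul_mem' := by
    rintro y z ⟨b, hb⟩ ⟨c, hc⟩
    exact ⟨b * c, by rw [mul_pow, hb, hc, map_mul]⟩
  add_mem' := by
    rintro y z ⟨b, hb⟩ ⟨c, hc⟩
    have : CharP (AlgebraicClosure (FractionRing B)) p :=
      charP_of_injective_algebraMap (R := B) (by
        rw [IsScalarTower.algebraMap_eq B (FractionRing B) (AlgebraicClosure (FractionRing B))]
        exact (algebraMap (FractionRing B) _).injective.comp
          (IsFractionRing.injective B (FractionRing B))) p
    exact ⟨b + c, by rw [add_pow_char_pow, hb, hc, map_add]⟩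
  algebraMap_mem' b := ⟨b ^ p ^ e, by rw [map_pow]⟩

/-- `M` has no free summand: no direct summand of `M` is isomorphic to `B`. -/
def NoFreeSummand (B M : Type*) [CommRing B] [AddCommGroup M] [Module B M] : Prop :=
  ¬ ∃ P Q : Submodule B M, IsCompl P Q ∧ Nonempty (P ≃ₗ[B] B)

/-- `B^{1/q} ≅ B^a ⊕ M` as `B`-modules, where `q = p ^ e`. -/
def RootDecomposition (B : Type*) [CommRing B] [IsDomain B] (p : ℕ) [Fact p.Prime] [CharP B p]
    (e a : ℕ) (M : Type*) [AddCommGroup M] [Module B M] : Prop :=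
  Nonempty (rootRing B p e ≃ₗ[B] (Fin a → B) × M)

/-- `(B^{1/q})_𝔪 ≅ (B_𝔪)^a ⊕ M` as modules over the localization `B_𝔪` of `B` at a prime
ideal `𝔪`, where `q = p ^ e`. -/
def LocalRootDecomposition (B : Type*) [CommRing B] [IsDomain B] (p : ℕ) [Fact p.Prime]
    [CharP B p] (𝔪 : Ideal B) [𝔪.IsPrime] (e a : ℕ) (M : Type*) [AddCommGroup M]
    [Module (Localization.AtPrime 𝔪) M] : Prop :=
  Nonempty (LocalizedModule 𝔪.primeCompl (rootRing B p e) ≃ₗ[Localization.AtPrime 𝔪]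
    (Fin a → Localization.AtPrime 𝔪) × M)

/-- The `R`-module `M` admits a grading, with rational degrees, that makes it a graded module
over `R`, where `R` is graded by the total degree of polynomials. -/
def IsGradable {K : Type*} [Field K] {n : ℕ} (R : Subalgebra K (MvPolynomial (Fin n) K))
    (M : Type*) [AddCommGroup M] [Module R M] : Prop :=
  ∃ 𝓜 : ℚ → AddSubgroup M, DirectSum.IsInternal 𝓜 ∧
    ∀ (d : ℕ) (c : ℚ) (r : R) (m : M),
      (r : MvPolynomial (Fin n) K).IsHomogeneous d → m ∈ 𝓜 c → r • m ∈ 𝓜 (d + c)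

/-! Put $q=p^e$, $\nu=\mu^t$, $J=\mathfrak a_t$ and $I=\mathfrak m_A^{[q]}\cap R$.

Colon formula (`colon_nonDivisorIdeal`): by fullness, divisibility of monomials in $R$ is comparison
of exponents, so each generator of $J$ has some exponent exceeding that of $\nu$. Conversely,
exchanging one factor $\mu_i$ of $\nu$ for $\eta_i$ gives $x_i\nu=a_i s$ with $a_i$ free of $x_i$.
Thus $s\in R$ exceeds $\nu$ in the $x_i$-exponent alone, and exactly by one. Comparing exponents
gives $J^{[q]}:\nu^q=I$; for $q=1$ this reads $J:\nu=\mathfrak m$.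

Free rank: reduce the free coordinates of $R^{1/q}\cong R^a\oplus M$ modulo $\mathfrak m$ to get a
surjection $R^{1/q}\to K^a$. Its kernel is $\{z: z^q\in I\}$. If $z^q\in I$, then $\nu z\in
JR^{1/q}$, so every functional sends $z$ into $J:\nu=\mathfrak m$. If $z^q\notin I$, some functional
sends $z$ outside $\mathfrak m$ (`exists_splitting`); functionals on $M$ take values in $\mathfrak
m$, so some free coordinate of $z$ is outside $\mathfrak m$. Hence $R/I\cong K^a$ up to the
Frobenius of $K$, which is bijective, and $\ell(R/I)=a$.

Functionals on $M$ avoid units since $M$ has no free summand. This suffices in the local case; in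
the graded case a homogeneous component of the functional is used
(`constantCoeff_eq_zero_of_isGradable`). -/

/-! ### Monomial subrings -/

section Subring

variable {K : Type*} [Field K] {n : ℕ} {S : AddSubmonoid (Fin n →₀ ℕ)}

theorem monomial_mem_monomialSubring {d : Fin n →₀ ℕ} (hd : d ∈ S) (c : K) :
    monomial d c ∈ monomialSubring K S := by
  have h : monomial d (1 : K) ∈ monomialSubring K S := Algebra.subset_adjoin ⟨d, hd, rfl⟩
  simpa [smul_monomial] using (monomialSubring K S).smul_mem h c

theorem mem_monomialSubring_iff {f : MvPolynomial (Fin n) K} :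
    f ∈ monomialSubring K S ↔ ∀ d ∈ f.support, d ∈ S := by
  classical
  constructor
  · intro hf
    induction hf using Algebra.adjoin_induction with
    | mem x hx =>
      obtain ⟨s, hs, rfl⟩ := hx
      intro d hd
      rw [Finset.mem_singleton.1 (support_monomial_subset hd)]
      exact hs
    | algebraMap r =>
      intro d hd
      rw [Finset.mem_singleton.1 (support_monomial_subset (s := 0) hd)]
      exact S.zero_mem
    | add x y _ _ hx hy =>
      intro d hd
      exact (Finset.mem_union.1 (support_add hd)).elim (hx d) (hy d)
    | mul x y _ _ hx hy =>
      intro d hd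
      obtain ⟨u, hu, v, hv, rfl⟩ := Finset.mem_add.1 (support_mul x y hd)
      exact S.add_mem (hx u hu) (hy v hv)
  · intro h
    rw [f.as_sum]
    exact Subalgebra.sum_mem _ fun d hd => monomial_mem_monomialSubring (h d hd) _

theorem mem_of_monomial_mem {d : Fin n →₀ ℕ} (h : monomial d (1 : K) ∈ monomialSubring K S) :
    d ∈ S :=
  mem_monomialSubring_iff.1 h d (by simp)

/-- The monomial of the subring `K[S]` with exponent in `S`. -/
noncomputable def sMonomial (K : Type*) [Field K] (d : S) : monomialSubring K S :=
  ⟨monomial d 1, monomial_mem_monomialSubring d.2 1⟩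

theorem eq_sum_smul_sMonomial (r : monomialSubring K S) :
    r = ∑ d ∈ (r : MvPolynomial (Fin n) K).support.attach,
      coeff d.1 (r : MvPolynomial (Fin n) K) •
        sMonomial K ⟨d.1, mem_monomialSubring_iff.1 r.2 d.1 d.2⟩ := by
  apply Subtype.ext
  rw [AddSubmonoidClass.coe_finsetSum]
  conv_lhs => rw [(r : MvPolynomial (Fin n) K).as_sum, ← Finset.sum_attach]
  simp [sMonomial, smul_monomial]

end Subring

/-! ### Bracket powers of ideals -/

section BracketPower

theorem bracketPower_eq_map (p : ℕ) [Fact p.Prime] {B : Type*} [CommRing B] [CharP B p] (I : Ideal B) (e : ℕ) :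
    bracketPower I (p ^ e) = I.map (iterateFrobenius B p e) := rfl

theorem bracketPower_span (p : ℕ) [Fact p.Prime] {B : Type*} [CommRing B] [CharP B p] (s : Set B) (e : ℕ) :
    bracketPower (Ideal.span s) (p ^ e) = Ideal.span ((fun x => x ^ p ^ e) '' s) := by
  rw [bracketPower_eq_map, Ideal.map_span]
  rfl

theorem mem_bracketPower_varIdeal (p : ℕ) [Fact p.Prime] {K : Type*} [Field K] [CharP K p] {n e : ℕ}
    {f : MvPolynomial (Fin n) K} :
    f ∈ bracketPower (varIdeal K n) (p ^ e) ↔ ∀ d ∈ f.support, ∃ i, p ^ e ≤ d i := by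
  have : ((fun x : MvPolynomial (Fin n) K => x ^ p ^ e) '' Set.range X) =
      (fun s => monomial s (1 : K)) '' Set.range fun i : Fin n => Finsupp.single i (p ^ e) := by
    rw [← Set.range_comp, ← Set.range_comp]
    congr 1
    ext1 i
    simp [X_pow_eq_monomial]
  rw [varIdeal, bracketPower_span, this, mem_ideal_span_monomial_image]
  simp

theorem comap_varIdeal {K : Type*} [Field K] {n : ℕ} (R : Subalgebra K (MvPolynomial (Fin n) K)) :
    (varIdeal K n).comap R.val = homMaxIdeal R := by
  ext r
  rw [Ideal.mem_comap, varIdeal, ← Set.image_univ, mem_ideal_span_X_image]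
  constructor
  · intro h
    by_contra h0
    obtain ⟨i, -, hi⟩ := h 0 (mem_support_iff.2 h0)
    exact hi rfl
  · intro hr d hd
    by_contra! h
    have : d = 0 := Finsupp.ext fun i => h i trivial
    subst this
    exact mem_support_iff.1 hd hr

theorem bracketPower_one {B : Type*} [CommRing B] (I : Ideal B) : bracketPower I 1 = I := by
  simp [bracketPower]

/-- The finitely generated ideal $\mathfrak m_A$ lies in the radical of $\mathfrak m_A^{[q]}$;
contract to $R$. This makes $R/I$ a module killed by a power of $\mathfrak m$. -/
theorem exists_pow_le_comap_bracketPower {K : Type*} [Field K] {n : ℕ} (p e : ℕ)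
    (R : Subalgebra K (MvPolynomial (Fin n) K)) :
    ∃ N, homMaxIdeal R ^ N ≤ (bracketPower (varIdeal K n) (p ^ e)).comap R.val := by
  obtain ⟨N, hN⟩ := Ideal.exists_pow_le_of_le_radical_of_fg
    (I := varIdeal K n) (J := bracketPower (varIdeal K n) (p ^ e))
    (fun f hf => ⟨p ^ e, Ideal.subset_span ⟨f, hf, rfl⟩⟩)
    (Submodule.fg_span (Set.finite_range _))
  refine ⟨N, le_trans ?_ (Ideal.comap_mono hN)⟩
  have h : homMaxIdeal R ≤ (varIdeal K n).comap R.val := (comap_varIdeal R).ge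
  exact (Ideal.pow_right_mono h N).trans (Ideal.le_comap_pow _ N)

end BracketPower

/-! ### The colon formula -/

section Colon

variable {K : Type*} [Field K] {n : ℕ} {S : AddSubmonoid (Fin n →₀ ℕ)}

/-- Every generator of `nonDivisorIdeal` has some exponent exceeding that of `ν`. -/
theorem exists_lt_of_not_dvd (hS : IsFull S) {ν r : monomialSubring K S} {m d : Fin n →₀ ℕ}
    (hν : (ν : MvPolynomial (Fin n) K) = monomial m 1)
    (hr : (r : MvPolynomial (Fin n) K) = monomial d 1) (h : ¬ r ∣ ν) : ∃ i, m i < d i := by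
  by_contra! hle
  have hdm : m - d + d = m := tsub_add_cancel_of_le hle
  have hd : d ∈ S := mem_of_monomial_mem (hr ▸ r.2)
  have hm : m ∈ S := mem_of_monomial_mem (hν ▸ ν.2)
  refine h ⟨sMonomial K ⟨m - d, hS _ d hd (hdm.symm ▸ hm)⟩, Subtype.ext ?_⟩
  simp [sMonomial, hν, hr, monomial_mul, add_comm d, hdm]

/-- Exponent comparison: $d+qm\ge qs$ with $s_i>m_i$ forces $d_i\ge q$. Conversely, if $d_i\ge q$,
the $s$ supplied by `H` satisfies $qs\le d+qm$, and fullness puts the quotient in $R$. -/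
theorem colon_nonDivisorIdeal (p : ℕ) [Fact p.Prime] [CharP K p] (hS : IsFull S) (e : ℕ)
    (ν : monomialSubring K S) (m : Fin n →₀ ℕ)
    (hν : (ν : MvPolynomial (Fin n) K) = monomial m 1)
    (H : ∀ i, ∃ s ∈ S, s i = m i + 1 ∧ s ≤ m + Finsupp.single i 1) :
    (bracketPower (nonDivisorIdeal (monomialSubring K S) ν) (p ^ e)).colon {ν ^ p ^ e} =
      (bracketPower (varIdeal K n) (p ^ e)).comap (monomialSubring K S).val := by
  classical
  have hq : 0 < p ^ e := pow_pos (Nat.Prime.pos Fact.out) e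
  have hνq : (ν : MvPolynomial (Fin n) K) ^ p ^ e = monomial (p ^ e • m) 1 := by
    rw [hν, monomial_pow, one_pow]
  have hm : m ∈ S := mem_of_monomial_mem (hν ▸ ν.2)
  ext r
  rw [Ideal.mem_comap, mem_bracketPower_varIdeal, Submodule.mem_colon_singleton, smul_eq_mul, Subalgebra.coe_val]
  constructor
  · intro h d hd
    -- In $A$ the bracket power lies in a monomial ideal, where membership can be tested on
    -- supports.
    have hle : bracketPower (nonDivisorIdeal (monomialSubring K S) ν) (p ^ e) ≤
        (Ideal.span ((fun s => monomial s (1 : K)) ''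
          {s | ∃ i, p ^ e * (m i + 1) ≤ s i})).comap (monomialSubring K S).val := by
      rw [nonDivisorIdeal, bracketPower_span, Ideal.span_le]
      rintro _ ⟨w, ⟨⟨s, hs⟩, hw⟩, rfl⟩
      obtain ⟨i, hi⟩ := exists_lt_of_not_dvd hS hν hs hw
      refine Ideal.subset_span ⟨p ^ e • s, ⟨i, ?_⟩, ?_⟩
      · simpa using Nat.mul_le_mul_left _ hi
      · simp [hs, monomial_pow]
    have h1 := hle h
    rw [Ideal.mem_comap, mem_ideal_span_monomial_image] at h1
    obtain ⟨s, ⟨i, hi⟩, hs⟩ := h1 (d + p ^ e • m) (by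
      simpa [hνq, coeff_mul_monomial] using hd)
    have := hi.trans (hs i)
    refine ⟨i, ?_⟩
    simp only [Finsupp.coe_add, Finsupp.coe_smul, Pi.add_apply, Pi.smul_apply, smul_eq_mul] at this
    linarith
  · intro h
    rw [eq_sum_smul_sMonomial r, Finset.sum_mul]
    refine Ideal.sum_mem _ fun ⟨d, hd⟩ _ => ?_
    rw [smul_mul_assoc]
    refine Submodule.smul_of_tower_mem _ _ ?_
    obtain ⟨i, hi⟩ := h d hd
    obtain ⟨s, hsS, hsi, hsm⟩ := H i
    have hle : p ^ e • s ≤ d + p ^ e • m := by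
      intro j
      have h1 := Nat.mul_le_mul_left (p ^ e) (hsm j)
      by_cases hj : i = j
      · subst hj
        simp only [Finsupp.coe_add, Pi.add_apply, Finsupp.single_eq_same, Finsupp.coe_smul,
          Pi.smul_apply, smul_eq_mul] at h1 ⊢
        linarith
      · simp only [Finsupp.coe_add, Pi.add_apply, Finsupp.single_eq_of_ne' hj, Finsupp.coe_smul,
          Pi.smul_apply, smul_eq_mul] at h1 ⊢
        linarith
    have hsum : d + p ^ e • m - p ^ e • s + p ^ e • s = d + p ^ e • m := tsub_add_cancel_of_le hle
    have hdS : d ∈ S := mem_monomialSubring_iff.1 r.2 d hd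
    have hc : d + p ^ e • m - p ^ e • s ∈ S :=
      hS _ (p ^ e • s) (S.nsmul_mem hsS _) (hsum.symm ▸ S.add_mem hdS (S.nsmul_mem hm _))
    have : sMonomial K ⟨d, hdS⟩ * ν ^ p ^ e = sMonomial K ⟨_, hc⟩ * sMonomial K ⟨s, hsS⟩ ^ p ^ e := by
      apply Subtype.ext
      simp [sMonomial, hνq, monomial_pow, monomial_mul, hsum]
    rw [this]
    refine Ideal.mul_mem_left _ _ (Ideal.subset_span ⟨_, Ideal.subset_span ⟨⟨s, rfl⟩, ?_⟩, rfl⟩)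
    -- The monomial of exponent $s$ does not divide $\nu$, since $s_i=m_i+1$.
    rintro ⟨c, hc⟩
    have h1 : monomial m (1 : K) = monomial s 1 * (c : MvPolynomial (Fin n) K) := by
      rw [← hν, hc]; rfl
    have h2 := congrArg (coeff m) h1
    rw [coeff_monomial_mul', if_neg] at h2
    · simp at h2
    · intro h3
      have := h3 i
      omega

end Colon

/-! ### Exponents of powers of $\mu$ -/

section Exponents

variable {K : Type*} [Field K] {n : ℕ} {S : AddSubmonoid (Fin n →₀ ℕ)}

/-- The exponent of `μ ^ t`, where `μ` is a multiple of each of the denominators `μ' i`. -/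
theorem exists_exponent_pow
    (a : Fin n → MvPolynomial (Fin n) K)
    (ha : ∀ i, ∃ d : Fin n →₀ ℕ, d i = 0 ∧ a i = monomial d 1)
    (μ' η : Fin n → monomialSubring K S)
    (hμ' : ∀ i, IsMonomial (μ' i : MvPolynomial (Fin n) K))
    (hη : ∀ i, IsMonomial (η i : MvPolynomial (Fin n) K))
    (hfrac : ∀ i, a i * (η i : MvPolynomial (Fin n) K) = X i * (μ' i : MvPolynomial (Fin n) K))
    (μ₀ : monomialSubring K S) (hμ₀ : IsMonomial (μ₀ : MvPolynomial (Fin n) K))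
    (μ : monomialSubring K S) (hμ : μ = μ₀ * ∏ i, μ' i)
    (t : ℕ) (ht : 1 ≤ t) :
    ∃ m : Fin n →₀ ℕ, ((μ ^ t : monomialSubring K S) : MvPolynomial (Fin n) K) = monomial m 1 ∧
      ∀ i, ∃ s ∈ S, s i = m i + 1 ∧ s ≤ m + Finsupp.single i 1 := by
  classical
  choose dA hdA ha using ha
  choose dm hdm using hμ'
  choose dh hdh using hη
  obtain ⟨d0, hd0⟩ := hμ₀
  have hmS : ∀ i, dm i ∈ S := fun i => mem_of_monomial_mem (hdm i ▸ (μ' i).2)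
  have hhS : ∀ i, dh i ∈ S := fun i => mem_of_monomial_mem (hdh i ▸ (η i).2)
  have h0S : d0 ∈ S := mem_of_monomial_mem (hd0 ▸ μ₀.2)
  have hμd : (μ : MvPolynomial (Fin n) K) = monomial (d0 + ∑ i, dm i) 1 := by
    rw [hμ]
    simp [hd0, hdm, ← monomial_sum_one, monomial_mul]
  refine ⟨t • (d0 + ∑ i, dm i), by simp [hμd, monomial_pow], fun i => ?_⟩
  have hexp : dA i + dh i = Finsupp.single i 1 + dm i := by
    have := hfrac i
    rw [ha, hdh, hdm, X, monomial_mul, monomial_mul, mul_one] at this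
    exact monomial_left_injective one_ne_zero this
  -- As the power is positive, one factor $\mu_i$ can be split off and exchanged for $\eta_i$.
  obtain ⟨t, rfl⟩ : ∃ k, t = k + 1 := ⟨t - 1, by omega⟩
  set M := d0 + ∑ i, dm i
  have hM : M = d0 + ∑ j ∈ Finset.univ.erase i, dm j + dm i := by
    rw [add_assoc, Finset.sum_erase_add _ _ (Finset.mem_univ i)]
  set M' := d0 + ∑ j ∈ Finset.univ.erase i, dm j
  have hM'S : M' ∈ S := S.add_mem h0S (S.sum_mem fun j _ => hmS j)
  have hMS : M ∈ S := hM ▸ S.add_mem hM'S (hmS i)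
  have key : dA i + (t • M + M' + dh i) = (t + 1) • M + Finsupp.single i 1 := by
    rw [add_left_comm, hexp, add_smul, one_smul]
    trans t • M + (M' + dm i) + Finsupp.single i 1
    · abel
    · rw [← hM]
  refine ⟨t • M + M' + dh i, S.add_mem (S.add_mem (S.nsmul_mem hMS _) hM'S) (hhS i), ?_, ?_⟩
  · have := DFunLike.congr_fun key i
    rw [Finsupp.add_apply, hdA, zero_add] at this
    simpa using this
  · rw [← key]
    exact le_add_self

end Exponents

/-! ### Coefficient extraction operators -/

section Extract

variable {σ K : Type*} [CommRing K]

open Classical in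
/-- The additive operator on polynomials reading off the coefficients of `f` along the
injection `h`, restricted to the exponents in `T`, and applying `s` to them. -/
noncomputable def extractCoeffs (s : K →+ K) (h : (σ →₀ ℕ) ↪ (σ →₀ ℕ)) (T : Set (σ →₀ ℕ)) :
    MvPolynomial σ K →+ MvPolynomial σ K :=
  have coeff_aux : ∀ (f : MvPolynomial σ K) (d : σ →₀ ℕ),
      coeff d (∑ d ∈ (f.support.preimage h h.injective.injOn) with d ∈ T,
        monomial d (s (coeff (h d) f))) = if d ∈ T then s (coeff (h d) f) else 0 := by
    intro f d
    rw [coeff_sum, Finset.sum_congr rfl fun x _ => coeff_monomial d x _, Finset.sum_ite_eq']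
    by_cases hd : d ∈ T
    · by_cases hf : coeff (h d) f = 0 <;> simp [hd, hf]
    · simp [hd]
  { toFun f := ∑ d ∈ (f.support.preimage h h.injective.injOn) with d ∈ T,
        monomial d (s (coeff (h d) f))
    map_zero' := by simp
    map_add' f g := by
      ext d
      rw [coeff_add, coeff_aux, coeff_aux, coeff_aux]
      split_ifs <;> simp }

open Classical in
theorem coeff_extractCoeffs (s : K →+ K) (h : (σ →₀ ℕ) ↪ (σ →₀ ℕ)) (T : Set (σ →₀ ℕ))
    (f : MvPolynomial σ K) (d : σ →₀ ℕ) :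
    coeff d (extractCoeffs s h T f) = if d ∈ T then s (coeff (h d) f) else 0 := by
  simp only [extractCoeffs, AddMonoidHom.coe_mk, ZeroHom.coe_mk]
  rw [coeff_sum, Finset.sum_congr rfl fun x _ => coeff_monomial d x _, Finset.sum_ite_eq']
  by_cases hd : d ∈ T
  · by_cases hf : coeff (h d) f = 0 <;> simp [hd, hf]
  · simp [hd]

theorem extractCoeffs_mem {K : Type*} [Field K] {n : ℕ} {S : AddSubmonoid (Fin n →₀ ℕ)}
    (s : K →+ K) (h) {T : Set (Fin n →₀ ℕ)} {f : MvPolynomial (Fin n) K}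
    (hT : ∀ d ∈ T, h d ∈ f.support → d ∈ S) :
    extractCoeffs s h T f ∈ monomialSubring K S := by
  refine mem_monomialSubring_iff.2 fun d hd => ?_
  rw [mem_support_iff, coeff_extractCoeffs] at hd
  by_cases hdT : d ∈ T
  · refine hT d hdT (mem_support_iff.2 fun h0 => hd ?_)
    simp [h0]
  · simp [hdT] at hd

end Extract

/-! ### Splittings by $q^{-1}$-linear maps -/

section Splitting

variable {K : Type*} [Field K] [PerfectField K] (p : ℕ) [Fact p.Prime] [CharP K p]
  {n : ℕ} {S : AddSubmonoid (Fin n →₀ ℕ)}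

/-- An element `b` of `R = K[S]` outside `𝔪_A^[q]` can be mapped out of the maximal ideal by
a `q⁻¹`-linear endomorphism of `R`. -/
theorem exists_splitting (hS : IsFull S) (e : ℕ) (b : monomialSubring K S)
    (hb : b ∉ (bracketPower (varIdeal K n) (p ^ e)).comap (monomialSubring K S).val) :
    ∃ Φ : monomialSubring K S →+ monomialSubring K S,
      (∀ r f, Φ (r ^ p ^ e * f) = r * Φ f) ∧ Φ b ∉ homMaxIdeal (monomialSubring K S) := by
  classical
  have hq : 0 < p ^ e := pow_pos (Nat.Prime.pos Fact.out) e
  have : ExpChar K p := ExpChar.prime Fact.out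
  rw [Ideal.mem_comap, mem_bracketPower_varIdeal] at hb
  push Not at hb
  obtain ⟨α, hα, hlt⟩ := hb
  -- Take the $q$-th roots of the coefficients at the exponents $qd+\alpha$, where all $\alpha_i<q$,
  -- and keep only $d\in S$ so as to land in $R$.
  let h : (Fin n →₀ ℕ) ↪ (Fin n →₀ ℕ) := ⟨fun d => p ^ e • d + α, fun d d' hd => by
    ext i
    have := DFunLike.congr_fun hd i
    exact Nat.eq_of_mul_eq_mul_left hq (by simpa using this)⟩
  have hdef : ∀ d, h d = p ^ e • d + α := fun _ => rfl
  let s : K →+ K := (iterateFrobeniusEquiv K p e).symm.toAddMonoidHom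
  have hs : ∀ c x : K, s (c ^ p ^ e * x) = c * s x := by
    intro c x
    change (iterateFrobeniusEquiv K p e).symm _ = _ * (iterateFrobeniusEquiv K p e).symm _
    rw [map_mul, ← iterateFrobeniusEquiv_def, RingEquiv.symm_apply_apply]
  let Ψ := extractCoeffs s h (S : Set (Fin n →₀ ℕ))
  have hΨ : ∀ r ∈ monomialSubring K S, ∀ f, Ψ (r ^ p ^ e * f) = r * Ψ f := by
    intro r hr
    induction hr using Algebra.adjoin_induction with
    | mem x hx =>
      obtain ⟨k, hk, rfl⟩ := hx
      intro f
      ext d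
      simp only [Ψ, coeff_extractCoeffs, monomial_pow, one_pow, coeff_monomial_mul', one_mul]
      -- Since $\alpha_i<q$, the shift by $\alpha$ does not affect divisibility by a $q$-th power.
      have hle : p ^ e • k ≤ h d ↔ k ≤ d := by
        refine ⟨fun hkd i => ?_, fun hkd i => ?_⟩
        · have h1 := hkd i
          have h2 := hlt i
          simp only [hdef, Finsupp.coe_add, Finsupp.coe_smul, Pi.add_apply, Pi.smul_apply,
            smul_eq_mul] at h1
          by_contra! h3
          have h4 := Nat.mul_le_mul_left (p ^ e) (Nat.succ_le_of_lt h3)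
          rw [Nat.mul_succ] at h4
          omega
        · have h1 := Nat.mul_le_mul_left (p ^ e) (hkd i)
          simp only [hdef, Finsupp.coe_add, Finsupp.coe_smul, Pi.add_apply, Pi.smul_apply,
            smul_eq_mul]
          omega
      by_cases hkd : k ≤ d
      · have hd : d - k + k = d := tsub_add_cancel_of_le hkd
        -- Fullness makes the restriction to exponents in $S$ linear over $R$.
        have hiff : d ∈ S ↔ d - k ∈ S :=
          ⟨fun H => hS _ k hk (hd.symm ▸ H), fun H => hd ▸ S.add_mem H hk⟩
        have hsub : h d - p ^ e • k = h (d - k) := by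
          rw [hdef, hdef]
          conv_lhs => rw [← hd, smul_add, add_right_comm]
          exact add_tsub_cancel_right _ _
        simp [hle, hkd, hiff, hsub]
      · simp [hle, hkd]
    | algebraMap c =>
      intro f
      ext d
      simp only [Ψ, algebraMap_eq, ← map_pow, coeff_C_mul, coeff_extractCoeffs, hs, mul_ite,
        mul_zero]
    | add x y _ _ hx hy =>
      intro f
      rw [add_pow_char_pow, add_mul, map_add, hx, hy, add_mul]
    | mul x y _ _ hx hy =>
      intro f
      rw [mul_pow, mul_assoc, hx, hy, mul_assoc]
  have hmem : ∀ f, Ψ f ∈ monomialSubring K S :=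
    fun f => extractCoeffs_mem s h fun d hd _ => hd
  refine ⟨(Ψ.comp (monomialSubring K S).val.toRingHom.toAddMonoidHom).codRestrict
    (monomialSubring K S) fun f => hmem f, fun r f => Subtype.ext (hΨ r r.2 f), ?_⟩
  intro h0
  change coeff 0 (Ψ b) = 0 at h0
  have hs0 : s (coeff α (b : MvPolynomial (Fin n) K)) = 0 := by
    simpa [Ψ, coeff_extractCoeffs, S.zero_mem, hdef] using h0
  refine mem_support_iff.1 hα ?_
  exact (map_eq_zero_iff (iterateFrobeniusEquiv K p e).symm
    (iterateFrobeniusEquiv K p e).symm.injective).1 hs0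

end Splitting

/-! ### Length over $B$ and over $K$ -/

section Length

/-- Over a `K`-algebra `B` with `B = K + 𝔪`, the length of a module killed by a power of `𝔪`
is its length over `K`. -/
theorem length_eq_length_of_pow_smul_eq_bot {K B : Type*} [Field K] [CommRing B] [Algebra K B]
    (𝔪 : Ideal B) (h : Function.Surjective (algebraMap K (B ⧸ 𝔪))) (N : ℕ) :
    ∀ (M : Type*) [AddCommGroup M] [Module B M] [Module K M] [IsScalarTower K B M],
      𝔪 ^ N • (⊤ : Submodule B M) = ⊥ → Module.length B M = Module.length K M := by
  induction N with
  | zero =>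
    intro M _ _ _ _ hN
    rw [pow_zero, Ideal.one_eq_top, Submodule.top_smul, eq_comm, subsingleton_iff_bot_eq_top,
      Submodule.subsingleton_iff] at hN
    rw [Module.length_eq_zero, Module.length_eq_zero]
  | succ N ih =>
    intro M _ _ _ _ hN
    -- Induct along $0\to\mathfrak mM\to M\to M/\mathfrak mM\to 0$: the submodule is killed by
    -- $\mathfrak m^N$, and on the quotient both rings act through $B/\mathfrak m$, onto which both
    -- surject.
    let P : Submodule B M := 𝔪 • ⊤
    rw [Module.length_eq_add_of_exact P.subtype P.mkQ P.injective_subtype P.mkQ_surjective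
        (LinearMap.exact_subtype_mkQ P),
      Module.length_eq_add_of_exact (P.subtype.restrictScalars K) (P.mkQ.restrictScalars K)
        P.injective_subtype P.mkQ_surjective (LinearMap.exact_subtype_mkQ P)]
    congr 1
    · refine ih P ?_
      refine Submodule.map_injective_of_injective P.injective_subtype ?_
      rw [Submodule.map_smul'', Submodule.map_top, Submodule.range_subtype, Submodule.map_bot,
        ← hN, pow_succ, mul_smul]
    · have : IsScalarTower K (B ⧸ 𝔪) (M ⧸ (𝔪 • ⊤ : Submodule B M)) := by
        refine ⟨fun c x y => ?_⟩
        obtain ⟨x, rfl⟩ := Ideal.Quotient.mk_surjective x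
        change Ideal.Quotient.mk 𝔪 (c • x) • y = c • (x • y)
        change (c • x) • y = c • (x • y)
        rw [smul_assoc]
      change Module.length B (M ⧸ (𝔪 • ⊤ : Submodule B M)) =
        Module.length K (M ⧸ (𝔪 • ⊤ : Submodule B M))
      rw [Module.length_eq_of_surjective (R := B ⧸ 𝔪) (S := B) Ideal.Quotient.mk_surjective,
        Module.length_eq_of_surjective (R := B ⧸ 𝔪) (S := K) h]

end Length

/-! ### The ring of $q$-th roots -/

section RootRing

variable {B : Type*} [CommRing B] [IsDomain B] (p : ℕ) [Fact p.Prime] [CharP B p] (e : ℕ)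

theorem algebraMap_algebraicClosure_injective (B : Type*) [CommRing B] [IsDomain B] :
    Function.Injective (algebraMap B (AlgebraicClosure (FractionRing B))) := by
  rw [IsScalarTower.algebraMap_eq B (FractionRing B) (AlgebraicClosure (FractionRing B))]
  exact (algebraMap (FractionRing B) _).injective.comp (IsFractionRing.injective B _)

instance rootRing.charP : CharP (rootRing B p e) p :=
  charP_of_injective_algebraMap (R := B) (fun _ _ hxy =>
    algebraMap_algebraicClosure_injective B (congrArg Subtype.val hxy)) p

theorem exists_root (b : B) :
    ∃ z : rootRing B p e, z ^ p ^ e = algebraMap B (rootRing B p e) b := by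
  obtain ⟨z, hz⟩ := IsAlgClosed.exists_pow_nat_eq
    (algebraMap B (AlgebraicClosure (FractionRing B)) b)
    (pow_pos (Nat.Prime.pos (Fact.out : p.Prime)) e)
  exact ⟨⟨z, b, hz⟩, Subtype.ext hz⟩

theorem exists_pow_eq (z : rootRing B p e) :
    ∃ b : B, z ^ p ^ e = algebraMap B (rootRing B p e) b := by
  obtain ⟨b, hb⟩ := z.2
  exact ⟨b, Subtype.ext hb⟩

theorem algebraMap_rootRing_injective :
    Function.Injective (algebraMap B (rootRing B p e)) := fun _ _ hxy =>
  algebraMap_algebraicClosure_injective B (congrArg Subtype.val hxy)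

/-- The ring isomorphism `B^{1/q} ≃ B` given by the `q`-th power. -/
noncomputable def rootRingEquiv : rootRing B p e ≃+* B :=
  (RingEquiv.ofBijective
    ((iterateFrobenius (rootRing B p e) p e).codRestrict
      (algebraMap B (rootRing B p e)).range fun z => by
        obtain ⟨b, hb⟩ := exists_pow_eq p e z
        exact ⟨b, hb.symm⟩)
    ⟨fun x y hxy => iterateFrobenius_inj _ p e (congrArg Subtype.val hxy), by
      rintro ⟨_, b, rfl⟩
      obtain ⟨z, hz⟩ := exists_root p e b
      exact ⟨z, Subtype.ext hz⟩⟩).trans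
  (RingEquiv.ofBijective (algebraMap B (rootRing B p e)).rangeRestrict
    ⟨fun _ _ hxy => algebraMap_rootRing_injective p e (congrArg Subtype.val hxy),
      (algebraMap B (rootRing B p e)).rangeRestrict_surjective⟩).symm

theorem algebraMap_rootRingEquiv (z : rootRing B p e) :
    algebraMap B (rootRing B p e) (rootRingEquiv p e z) = z ^ p ^ e := by
  have := RingEquiv.apply_symm_apply (RingEquiv.ofBijective
    (algebraMap B (rootRing B p e)).rangeRestrict
    ⟨fun _ _ hxy => algebraMap_rootRing_injective p e (congrArg Subtype.val hxy),
      (algebraMap B (rootRing B p e)).rangeRestrict_surjective⟩)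
    ((iterateFrobenius (rootRing B p e) p e).codRestrict
      (algebraMap B (rootRing B p e)).range (fun z => by
        obtain ⟨b, hb⟩ := exists_pow_eq p e z
        exact ⟨b, hb.symm⟩) z)
  exact congrArg Subtype.val this

/-- Hence $q^{-1}$-linear endomorphisms of $B$ yield $B$-linear functionals on $B^{1/q}$. -/
theorem rootRingEquiv_smul (r : B) (z : rootRing B p e) :
    rootRingEquiv p e (r • z) = r ^ p ^ e * rootRingEquiv p e z := by
  apply algebraMap_rootRing_injective p e
  rw [map_mul, algebraMap_rootRingEquiv, algebraMap_rootRingEquiv, smul_pow, Algebra.smul_def]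

end RootRing

/-! ### Length from a surjection onto $K^a$ -/

section Counting

variable {K : Type*} [Field K] [PerfectField K] (p : ℕ) [Fact p.Prime] [CharP K p]
  {B : Type*} [CommRing B] [IsDomain B] [CharP B p] [Algebra K B] (χ : B →ₐ[K] K)

theorem algebraMap_quotient_ker_surjective {K B : Type*} [Field K] [CommRing B] [Algebra K B]
    (χ : B →ₐ[K] K) : Function.Surjective (algebraMap K (B ⧸ RingHom.ker χ)) := by
  intro x
  obtain ⟨r, rfl⟩ := Ideal.Quotient.mk_surjective x
  refine ⟨χ r, ?_⟩
  change Ideal.Quotient.mk _ (algebraMap K B _) = _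
  rw [Ideal.Quotient.eq, RingHom.mem_ker, map_sub, AlgHom.commutes]
  exact sub_self _

/-- If `B^{1/q}` maps onto `K^a` with kernel the `q`-th roots of elements of `I`, then `B/I` has
length `a`. -/
theorem colength_eq_of_surjective (e a : ℕ) (I : Ideal B) (hI : ∃ N, RingHom.ker χ ^ N ≤ I)
    (g : rootRing B p e →+ (Fin a → K)) (hg : Function.Surjective g)
    (hsmul : ∀ (r : B) z, g (r • z) = χ r • g z)
    (hker : ∀ z, g z = 0 ↔ rootRingEquiv p e z ∈ I) :
    colength I = a := by
  have : ExpChar K p := ExpChar.prime Fact.out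
  obtain ⟨N, hN⟩ := hI
  rw [colength, length_eq_length_of_pow_smul_eq_bot (K := K) (RingHom.ker χ)
    (algebraMap_quotient_ker_surjective χ) N (B ⧸ I) (by
      rw [eq_bot_iff, Submodule.smul_le]
      intro r hr x _
      obtain ⟨x, rfl⟩ := Ideal.Quotient.mk_surjective x
      change Ideal.Quotient.mk I (r * x) = 0
      exact Ideal.Quotient.eq_zero_iff_mem.2 (I.mul_mem_right _ (hN hr)))]
  let G : B →+ (Fin a → K) := g.comp (rootRingEquiv p e).symm.toAddMonoidHom
  have hGker : G.ker = I.toAddSubgroup := by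
    ext b
    rw [AddMonoidHom.mem_ker]
    change g ((rootRingEquiv p e).symm b) = 0 ↔ b ∈ I
    rw [hker, RingEquiv.apply_symm_apply]
  have hGsurj : Function.Surjective G := hg.comp (rootRingEquiv p e).symm.surjective
  have hG : ∀ (c : K) b, G (c ^ p ^ e • b) = c • G b := by
    intro c b
    change g ((rootRingEquiv p e).symm (c ^ p ^ e • b)) = c • g ((rootRingEquiv p e).symm b)
    obtain ⟨z, rfl⟩ := (rootRingEquiv p e).surjective b
    have : c ^ p ^ e • rootRingEquiv p e z = rootRingEquiv p e ((algebraMap K B c) • z) := by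
      rw [rootRingEquiv_smul, Algebra.smul_def, map_pow]
    rw [this, RingEquiv.symm_apply_apply, RingEquiv.symm_apply_apply, hsmul, AlgHom.commutes]
    rfl
  let j : (B ⧸ I) ≃+ (Fin a → K) :=
    (QuotientAddGroup.quotientAddEquivOfEq hGker.symm).trans
      (QuotientAddGroup.quotientKerEquivOfSurjective G hGsurj)
  -- Semilinearity over a bijection of the scalars, available as $K$ is perfect, suffices to compare
  -- dimensions.
  have hj : ∀ (c : K) x, j (c • x) = (iterateFrobeniusEquiv K p e).symm c • j x := by
    intro c x
    obtain ⟨x, rfl⟩ := Ideal.Quotient.mk_surjective x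
    obtain ⟨c, rfl⟩ := (iterateFrobeniusEquiv K p e).surjective c
    rw [RingEquiv.symm_apply_apply]
    exact hG c x
  have hrank := lift_rank_eq_of_equiv_equiv _ j (iterateFrobeniusEquiv K p e).symm.bijective hj
  rw [Module.length_eq_rank]
  have h1 : Cardinal.toENat (Module.rank K (B ⧸ I)) =
      Cardinal.toENat (Module.rank K (Fin a → K)) := by
    simpa using congrArg Cardinal.toENat hrank
  rw [h1]
  simp

end Counting

/-! ### Free rank when functionals on the complement avoid units -/

section FreeRank

variable {K : Type*} [Field K] [PerfectField K] (p : ℕ) [Fact p.Prime] [CharP K p]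
  {B : Type*} [CommRing B] [IsDomain B] [CharP B p] [Algebra K B] (χ : B →ₐ[K] K)

theorem exists_linearMap_rootRing {K : Type*} [Field K] (p : ℕ) [Fact p.Prime]
    {B : Type*} [CommRing B] [IsDomain B] [CharP B p] [Algebra K B] (χ : B →ₐ[K] K)
    (e : ℕ) (z : rootRing B p e)
    (h : ∃ Φ : B →+ B, (∀ r f, Φ (r ^ p ^ e * f) = r * Φ f) ∧ χ (Φ (rootRingEquiv p e z)) ≠ 0) :
    ∃ φ : rootRing B p e →ₗ[B] B, χ (φ z) ≠ 0 := by
  obtain ⟨Φ, hΦ, hz⟩ := h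
  exact ⟨{ toFun := fun w => Φ (rootRingEquiv p e w)
           map_add' := fun x y => by rw [map_add, map_add]
           map_smul' := fun r x => by
             rw [rootRingEquiv_smul, hΦ, RingHom.id_apply, smul_eq_mul] }, hz⟩

/-- A `q`-th root of an element of `J^[q] :_B ν^q` becomes an element of `J B^{1/q}` after
multiplication by `ν`. -/
theorem smul_mem_of_mem_colon (e : ℕ) (J : Ideal B) (ν : B) (z : rootRing B p e)
    (hz : rootRingEquiv p e z ∈ (bracketPower J (p ^ e)).colon {ν ^ p ^ e}) :
    ν • z ∈ J • (⊤ : Submodule B (rootRing B p e)) := by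
  rw [Submodule.mem_colon_singleton, smul_eq_mul, mul_comm, ← rootRingEquiv_smul] at hz
  obtain ⟨w, hw⟩ : ∃ w, w = ν • z := ⟨_, rfl⟩
  rw [← hw] at hz ⊢
  clear hw
  -- The $q$-th root of $y^q$ is $y\cdot 1$, so $q$-th roots of elements of $J^{[q]}$ lie in
  -- $JB^{1/q}$.
  have key : ∀ b ∈ bracketPower J (p ^ e),
      (rootRingEquiv p e).symm b ∈ J • (⊤ : Submodule B (rootRing B p e)) := by
    intro b hb
    induction hb using Submodule.span_induction with
    | mem x hx =>
      obtain ⟨y, hy, rfl⟩ := hx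
      have : (rootRingEquiv p e).symm (y ^ p ^ e) = y • 1 := by
        rw [RingEquiv.symm_apply_eq, rootRingEquiv_smul, map_one, mul_one]
      simp only [this]
      exact Submodule.smul_mem_smul hy trivial
    | zero => rw [map_zero]; exact zero_mem _
    | add x y _ _ hx hy => rw [map_add]; exact add_mem hx hy
    | smul r x _ hx =>
      rw [smul_eq_mul, map_mul]
      generalize (rootRingEquiv p e).symm r = s
      refine Submodule.smul_induction_on hx (fun b hb y _ => ?_) fun x y hx hy => ?_
      · rw [mul_smul_comm]
        exact Submodule.smul_mem_smul hb trivial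
      · rw [mul_add]
        exact add_mem hx hy
  simpa using key _ hz

/-- If `ρ` kills the values of all functionals on the complement `M` of a free module, then an
element whose free coordinates are killed by `ρ` has all its functionals killed by `ρ`. -/
theorem map_functional_eq_zero {K B N M : Type*} [Field K] [CommRing B] (ρ : B →+* K)
    [AddCommGroup N] [Module B N] [AddCommGroup M] [Module B M] {a : ℕ}
    (i : N ≃ₗ[B] (Fin a → B) × M) (hM : ∀ (φ : M →ₗ[B] B) m, ρ (φ m) = 0)
    {z : N} (hz : ∀ j, ρ ((i z).1 j) = 0) (φ : N →ₗ[B] B) : ρ (φ z) = 0 := by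
  have h1 : φ z = φ (i.symm ((i z).1, 0)) + φ (i.symm (0, (i z).2)) := by
    rw [← map_add, ← map_add]; simp
  have h2 : ((i z).1, (0 : M)) = ∑ j, (i z).1 j • (Pi.single j (1 : B), (0 : M)) := by
    ext1
    · simpa [Prod.fst_sum] using (pi_eq_sum_univ' (i z).1)
    · simp [Prod.snd_sum]
  have h3 : ρ (φ (i.symm (0, (i z).2))) = 0 :=
    hM (φ ∘ₗ i.symm.toLinearMap ∘ₗ LinearMap.inr B _ M) _
  rw [h1, map_add, h3, h2, map_sum, map_sum, map_sum, add_zero]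
  refine Finset.sum_eq_zero fun j _ => ?_
  rw [map_smul, map_smul, smul_eq_mul, map_mul, hz, zero_mul]

/-- The free rank of `B^{1/q}` for a decomposition whose complement maps into `ker χ`. -/
theorem colength_eq_of_rootDecomposition (e a : ℕ) (I : Ideal B)
    (hI : ∃ N, RingHom.ker χ ^ N ≤ I)
    (hsplit : ∀ b ∉ I, ∃ Φ : B →+ B, (∀ r f, Φ (r ^ p ^ e * f) = r * Φ f) ∧ χ (Φ b) ≠ 0)
    (J : Ideal B) (ν : B) (hJ : J.colon {ν} = RingHom.ker χ)
    (hJI : (bracketPower J (p ^ e)).colon {ν ^ p ^ e} = I)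
    (M : Type*) [AddCommGroup M] [Module B M]
    (hM : ∀ (φ : M →ₗ[B] B) m, χ (φ m) = 0)
    (hdec : RootDecomposition B p e a M) : colength I = a := by
  obtain ⟨i⟩ := hdec
  refine colength_eq_of_surjective p χ e a I hI
    { toFun := fun z j => χ ((i z).1 j)
      map_zero' := by ext; simp
      map_add' := fun x y => by ext; simp } ?_ ?_ ?_
  · intro v
    refine ⟨i.symm (fun j => algebraMap K B (v j), 0), ?_⟩
    ext j
    simp
  · intro r z
    ext j
    simp
  · intro z
    constructor
    · intro hz
      by_contra hzI
      obtain ⟨φ, hφ⟩ := exists_linearMap_rootRing p χ e z (hsplit _ hzI)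
      exact hφ (map_functional_eq_zero (χ : B →+* K) i hM (fun j => congrFun hz j) φ)
    · intro hz
      ext j
      have h1 := smul_mem_of_mem_colon p e J ν z (hJI ▸ hz)
      -- The $j$-th coordinate maps $\nu z\in JB^{1/q}$ into $J$, so it maps $z$ into
      -- $J:\nu=\ker\chi$.
      let φ : rootRing B p e →ₗ[B] B := LinearMap.proj j ∘ₗ LinearMap.fst B _ M ∘ₗ i.toLinearMap
      have h2 : φ (ν • z) ∈ J := by
        have := Submodule.mem_map_of_mem (f := φ) h1
        rw [Submodule.map_smul''] at this
        exact (Ideal.mul_le_left : J * _ ≤ J) this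
      have h3 : φ z ∈ J.colon {ν} := by
        rw [Submodule.mem_colon_singleton, smul_eq_mul, mul_comm]
        simpa using h2
      rw [hJ] at h3
      exact h3

end FreeRank

/-! ### Modules without free summand -/

section FreeSummand

/-- If $\varphi(m)$ were a unit, then $M=Bm\oplus\ker\varphi$ with $Bm\cong B$. -/
theorem not_isUnit_of_noFreeSummand {B M : Type*} [CommRing B] [AddCommGroup M] [Module B M]
    (h : NoFreeSummand B M) (φ : M →ₗ[B] B) (m : M) : ¬ IsUnit (φ m) := by
  rintro hu
  obtain ⟨c, hc⟩ := hu.exists_left_inv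
  have hinj : ∀ b : B, φ (b • m) = 0 → b = 0 := by
    intro b hb
    rw [map_smul, smul_eq_mul] at hb
    rw [← mul_one b, ← hc, mul_left_comm, hb, mul_zero]
  refine h ⟨LinearMap.range (LinearMap.toSpanSingleton B M m), LinearMap.ker φ, ⟨?_, ?_⟩,
    ⟨(LinearEquiv.ofInjective (LinearMap.toSpanSingleton B M m) ?_).symm⟩⟩
  · rw [Submodule.disjoint_def]
    rintro _ ⟨b, rfl⟩ hb
    rw [LinearMap.toSpanSingleton_apply] at hb ⊢
    rw [hinj b hb, zero_smul]
  · rw [codisjoint_iff, eq_top_iff]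
    intro x _
    have hx : x = (φ x * c) • m + (x - (φ x * c) • m) := by abel
    rw [hx]
    refine Submodule.add_mem_sup ⟨_, rfl⟩ ?_
    rw [LinearMap.mem_ker, map_sub, map_smul, smul_eq_mul, mul_assoc, hc, mul_one, sub_self]
  · rw [← LinearMap.ker_eq_bot, LinearMap.ker_eq_bot']
    intro b hb
    refine hinj b ?_
    rw [LinearMap.toSpanSingleton_apply] at hb
    rw [hb, map_zero]

end FreeSummand

/-! ### The local case -/

section Local

variable {K : Type*} [Field K] [PerfectField K] (p : ℕ) [Fact p.Prime] [CharP K p]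
  {B : Type*} [CommRing B] [IsDomain B] [CharP B p] [Algebra K B] (χ : B →ₐ[K] K)

/-- The free rank of `B^{1/q}` after localization at `𝔪 = ker χ`. -/
theorem colength_eq_of_localRootDecomposition (e a : ℕ) (I : Ideal B)
    (hI : ∃ N, RingHom.ker χ ^ N ≤ I)
    (hsplit : ∀ b ∉ I, ∃ Φ : B →+ B, (∀ r f, Φ (r ^ p ^ e * f) = r * Φ f) ∧ χ (Φ b) ≠ 0)
    (J : Ideal B) (ν : B) (hJ : J.colon {ν} = RingHom.ker χ)
    (hJI : (bracketPower J (p ^ e)).colon {ν ^ p ^ e} = I)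
    (𝔪 : Ideal B) [𝔪.IsPrime] (h𝔪 : ∀ b, b ∈ 𝔪 ↔ χ b = 0)
    (M : Type*) [AddCommGroup M] [Module (Localization.AtPrime 𝔪) M]
    (hM : NoFreeSummand (Localization.AtPrime 𝔪) M)
    (hdec : LocalRootDecomposition B p 𝔪 e a M) : colength I = a := by
  obtain ⟨i⟩ := hdec
  have hunit : ∀ s : 𝔪.primeCompl, IsUnit ((χ : B →+* K) s) := fun s =>
    isUnit_iff_ne_zero.2 fun h => s.2 ((h𝔪 s).2 h)
  let ρ : Localization.AtPrime 𝔪 →+* K := IsLocalization.lift (M := 𝔪.primeCompl) hunit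
  have hρ : ∀ b, ρ (algebraMap B _ b) = χ b := fun b => IsLocalization.lift_eq hunit b
  -- $\rho$ is the residue map of the local ring, so its kernel consists of the nonunits.
  have hρu : ∀ x, ρ x ≠ 0 → IsUnit x := by
    intro x hx
    obtain ⟨b, s, rfl⟩ := IsLocalization.exists_mk'_eq 𝔪.primeCompl x
    refine (IsLocalization.AtPrime.isUnit_mk'_iff _ 𝔪 b s).2 fun hb => hx ?_
    have hb' : (χ : B →+* K) b = 0 := (h𝔪 b).1 hb
    rw [IsLocalization.lift_mk', hb', zero_mul]
  have hMρ : ∀ (φ : M →ₗ[Localization.AtPrime 𝔪] Localization.AtPrime 𝔪) m, ρ (φ m) = 0 := by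
    intro φ m
    by_contra h
    exact not_isUnit_of_noFreeSummand hM φ m (hρu _ h)
  let ι := LocalizedModule.mkLinearMap 𝔪.primeCompl (rootRing B p e)
  let γ : rootRing B p e →ₗ[B] (Fin a → Localization.AtPrime 𝔪) :=
    (LinearMap.fst (Localization.AtPrime 𝔪) _ M ∘ₗ i.toLinearMap).restrictScalars B ∘ₗ ι
  have hγ : ∀ z, γ z = (i (ι z)).1 := fun z => rfl
  refine colength_eq_of_surjective p χ e a I hI
    { toFun := fun z j => ρ (γ z j)
      map_zero' := by ext; simp
      map_add' := fun x y => by ext; simp } ?_ ?_ ?_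
  · intro v
    obtain ⟨x, hx⟩ := i.surjective (fun j => algebraMap B _ (algebraMap K B (v j)), 0)
    obtain ⟨⟨z, s⟩, hz⟩ := IsLocalizedModule.surj 𝔪.primeCompl ι x
    have hs : χ s ≠ 0 := (hunit s).ne_zero
    -- The preimage $x$ is $z/s$; modulo $\mathfrak m$, dividing by $s$ is scaling by
    -- $\chi(s)^{-1}$.
    refine ⟨algebraMap K B (χ s)⁻¹ • z, ?_⟩
    ext j
    have h1 : γ z j = algebraMap B _ (s : B) * algebraMap B _ (algebraMap K B (v j)) := by
      change s • x = ι z at hz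
      rw [hγ, ← hz, Submonoid.smul_def, ← algebraMap_smul (Localization.AtPrime 𝔪) (s : B) x,
        map_smul, hx]
      rfl
    change ρ (γ (algebraMap K B (χ s)⁻¹ • z) j) = v j
    rw [map_smul, Pi.smul_apply, Algebra.smul_def, map_mul, h1, map_mul, hρ, hρ, hρ,
      AlgHom.commutes, AlgHom.commutes]
    exact inv_mul_cancel_left₀ hs _
  · intro r z
    ext j
    change ρ (γ (r • z) j) = χ r * ρ (γ z j)
    rw [map_smul, Pi.smul_apply, Algebra.smul_def, map_mul, hρ]
  · intro z
    constructor
    · intro hz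
      by_contra hzI
      obtain ⟨φ, hφ⟩ := exists_linearMap_rootRing p χ e z (hsplit _ hzI)
      let φ' := IsLocalizedModule.map 𝔪.primeCompl ι
        (Algebra.linearMap B (Localization.AtPrime 𝔪)) φ
      have h1 : φ' (ι z) = algebraMap B _ (φ z) :=
        IsLocalizedModule.map_apply 𝔪.primeCompl ι _ φ z
      have h2 := map_functional_eq_zero ρ i hMρ (z := ι z) (fun j => congrFun hz j)
        (φ'.extendScalarsOfIsLocalization 𝔪.primeCompl (Localization.AtPrime 𝔪))
      rw [LinearMap.extendScalarsOfIsLocalization_apply', h1, hρ] at h2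
      exact hφ h2
    · intro hz
      ext j
      have h1 := smul_mem_of_mem_colon p e J ν z (hJI ▸ hz)
      let φ : rootRing B p e →ₗ[B] Localization.AtPrime 𝔪 := LinearMap.proj j ∘ₗ γ
      have h2 : φ (ν • z) ∈ J.map (algebraMap B (Localization.AtPrime 𝔪)) := by
        have := Submodule.mem_map_of_mem (f := φ) h1
        rw [Submodule.map_smul''] at this
        refine Submodule.smul_induction_on this (fun b hb x _ => ?_) fun x y hx hy => add_mem hx hy
        rw [Algebra.smul_def]
        exact Ideal.mul_mem_right _ _ (Ideal.mem_map_of_mem _ hb)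
      rw [map_smul] at h2
      change ρ (φ z) = 0
      generalize φ z = y at h2
      obtain ⟨b, s, rfl⟩ := IsLocalization.exists_mk'_eq 𝔪.primeCompl y
      obtain ⟨⟨c, u⟩, hcu⟩ := (IsLocalization.mem_map_algebraMap_iff 𝔪.primeCompl _).1 h2
      -- Clearing denominators gives $bu\in J:\nu=\ker\chi$ in $B$; as $\chi(u)\ne0$, $\chi(b)=0$.
      have h3 : ν * b * u = c * s := by
        apply IsLocalization.injective (Localization.AtPrime 𝔪) 𝔪.primeCompl_le_nonZeroDivisors
        rw [map_mul, map_mul, map_mul, ← hcu, Algebra.smul_def]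
        simp only [mul_assoc]
        rw [mul_comm (algebraMap B _ (u : B)), ← mul_assoc (IsLocalization.mk' _ b s),
          IsLocalization.mk'_spec]
      have h4 : b * u ∈ J.colon {ν} := by
        rw [Submodule.mem_colon_singleton, smul_eq_mul, mul_comm, ← mul_assoc, h3]
        exact J.mul_mem_right _ c.2
      rw [hJ, RingHom.mem_ker, map_mul] at h4
      have hb : (χ : B →+* K) b = 0 := (mul_eq_zero.1 h4).resolve_right (hunit u).ne_zero
      rw [IsLocalization.lift_mk', hb, zero_mul]

end Local

/-! ### The graded case -/

section Graded

variable {K : Type*} [Field K] {n : ℕ} {S : AddSubmonoid (Fin n →₀ ℕ)}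

theorem monomialSubring_induction {P : monomialSubring K S → Prop} (zero : P 0)
    (add : ∀ x y, P x → P y → P (x + y))
    (monomial : ∀ (d : Fin n →₀ ℕ) (hd : d ∈ S) (c : K),
      P ⟨MvPolynomial.monomial d c, monomial_mem_monomialSubring hd c⟩)
    (r : monomialSubring K S) : P r := by
  rw [eq_sum_smul_sMonomial r]
  refine Finset.sum_induction _ P add zero fun d _ => ?_
  convert monomial d.1 (mem_monomialSubring_iff.1 r.2 d.1 d.2) (coeff d.1 r.1) using 1
  exact Subtype.ext (by simp [sMonomial, smul_monomial])

/-- The projection of `K[S]` onto its homogeneous component of degree `x`, for `x` rational. -/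
noncomputable def ratComponent (K : Type*) [Field K] {n : ℕ} (S : AddSubmonoid (Fin n →₀ ℕ))
    (x : ℚ) : monomialSubring K S →+ monomialSubring K S :=
  ((extractCoeffs (AddMonoidHom.id K) (Function.Embedding.refl _)
      {d : Fin n →₀ ℕ | (d.degree : ℚ) = x}).comp
    (monomialSubring K S).val.toRingHom.toAddMonoidHom).codRestrict (monomialSubring K S)
    fun f => extractCoeffs_mem _ _ fun d _ hd => mem_monomialSubring_iff.1 f.2 d hd

open Classical in
theorem coeff_ratComponent (x : ℚ) (f : monomialSubring K S) (d : Fin n →₀ ℕ) :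
    coeff d (ratComponent K S x f : MvPolynomial (Fin n) K) =
      if (d.degree : ℚ) = x then coeff d (f : MvPolynomial (Fin n) K) else 0 := by
  refine (coeff_extractCoeffs _ _ _ _ d).trans ?_
  simp

theorem ratComponent_monomial_mul (x : ℚ) {d : Fin n →₀ ℕ} (hd : d ∈ S) (c : K)
    (f : monomialSubring K S) :
    ratComponent K S (d.degree + x) (⟨monomial d c, monomial_mem_monomialSubring hd c⟩ * f) =
      ⟨monomial d c, monomial_mem_monomialSubring hd c⟩ * ratComponent K S x f := by
  classical
  ext k
  rw [coeff_ratComponent, MulMemClass.coe_mul, MulMemClass.coe_mul, coeff_monomial_mul',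
    coeff_monomial_mul', coeff_ratComponent]
  by_cases h : d ≤ k
  · obtain ⟨l, rfl⟩ := exists_add_of_le h
    simp
  · simp [h]

/-- A functional on a gradable module without free summand takes values in the homogeneous
maximal ideal. -/
theorem constantCoeff_eq_zero_of_isGradable {M : Type*} [AddCommGroup M]
    [Module (monomialSubring K S) M] (hgr : IsGradable (monomialSubring K S) M)
    (hM : NoFreeSummand (monomialSubring K S) M)
    (φ : M →ₗ[monomialSubring K S] monomialSubring K S) (m : M) :
    constantCoeff (φ m : MvPolynomial (Fin n) K) = 0 := by
  classical
  obtain ⟨𝓜, hint, hsmul⟩ := hgr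
  let dec := (AddEquiv.ofBijective (DirectSum.coeAddMonoidHom 𝓜) hint).symm
  have hdec : ∀ d (v : 𝓜 d), dec (v : M) = DirectSum.of (fun i => 𝓜 i) d v := by
    intro d v
    rw [AddEquiv.symm_apply_eq]
    exact (DirectSum.coeAddMonoidHom_of 𝓜 d v).symm
  have hind : ∀ {P : M → Prop}, P 0 → (∀ x y, P x → P y → P (x + y)) →
      (∀ d, ∀ v ∈ 𝓜 d, P v) → ∀ v, P v := by
    intro P h0 hadd hmem v
    rw [← dec.symm_apply_apply v]
    induction dec v using DirectSum.induction_on with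
    | zero => rwa [map_zero]
    | of d w => rw [← hdec, dec.symm_apply_apply]; exact hmem d w w.2
    | add x y hx hy => rw [map_add]; exact hadd _ _ hx hy
  by_contra hm
  -- By additivity, some homogeneous $u$ already has a value with nonzero constant term.
  obtain ⟨c, u, hu, hcu⟩ : ∃ c, ∃ u ∈ 𝓜 c,
      constantCoeff (φ u : MvPolynomial (Fin n) K) ≠ 0 := by
    by_contra! hall
    refine hm (hind (P := fun v => constantCoeff (φ v : MvPolynomial (Fin n) K) = 0) ?_ ?_
      hall m)
    · simp
    · intro x y hx hy
      rw [map_add, Subalgebra.coe_add, map_add, hx, hy, add_zero]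
  -- The component of $\varphi$ of degree $-c$: it is still linear, and it sends $u$ to the constant
  -- term of $\varphi(u)$, a unit.
  let ψ : M →+ monomialSubring K S := (DirectSum.toAddMonoid fun d =>
    ((ratComponent K S (d - c)).comp φ.toAddMonoidHom).comp (𝓜 d).subtype).comp dec.toAddMonoidHom
  have hψ : ∀ d, ∀ v ∈ 𝓜 d, ψ v = ratComponent K S (d - c) (φ v) := by
    intro d v hv
    change DirectSum.toAddMonoid _ (dec v) = _
    rw [hdec d ⟨v, hv⟩, DirectSum.toAddMonoid_of]
    rfl
  have hlin : ∀ (r : monomialSubring K S) v, ψ (r • v) = r • ψ v := by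
    intro r v
    refine monomialSubring_induction (P := fun r => ψ (r • v) = r • ψ v) ?_ ?_ ?_ r
    · simp
    · intro x y hx hy
      rw [add_smul, map_add, hx, hy, add_smul]
    · intro k hk a
      refine hind (P := fun v => ψ (_ • v) = _ • ψ v) ?_ ?_ ?_ v
      · simp
      · intro x y hx hy
        rw [smul_add, map_add, hx, hy, map_add, smul_add]
      · intro d v hv
        rw [hψ d v hv, hψ _ _ (hsmul k.degree d _ v (isHomogeneous_monomial a rfl) hv), map_smul,
          smul_eq_mul, smul_eq_mul, add_sub_assoc, ratComponent_monomial_mul _ hk]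
  have hunit : IsUnit (ψ u) := by
    have : ψ u = algebraMap K _ (constantCoeff (φ u : MvPolynomial (Fin n) K)) := by
      rw [hψ c u hu, sub_self]
      ext k
      rw [coeff_ratComponent, Subalgebra.coe_algebraMap, algebraMap_eq, coeff_C]
      by_cases hk : k = 0
      · simp [hk, constantCoeff_eq]
      · simp [Ne.symm hk, Finsupp.degree_eq_zero_iff, hk]
    rw [this]
    exact (isUnit_iff_ne_zero.2 hcu).map _
  exact not_isUnit_of_noFreeSummand hM
    { toFun := ψ, map_add' := map_add ψ, map_smul' := hlin } u hunit

end Graded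
-- The colon formula and the free ranks of $R^{1/q}$
theorem lemma2p2 {K : Type*} [Field K] [PerfectField K] (p : ℕ) [Fact p.Prime] [CharP K p]
    {n : ℕ} (S : AddSubmonoid (Fin n →₀ ℕ)) (hS : IsFull S)
    (a : Fin n → MvPolynomial (Fin n) K)
    (ha : ∀ i, ∃ d : Fin n →₀ ℕ, d i = 0 ∧ a i = monomial d 1)
    (μ' η : Fin n → monomialSubring K S)
    (hμ' : ∀ i, IsMonomial (μ' i : MvPolynomial (Fin n) K))
    (hη : ∀ i, IsMonomial (η i : MvPolynomial (Fin n) K))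
    (hfrac : ∀ i, a i * (η i : MvPolynomial (Fin n) K) = X i * (μ' i : MvPolynomial (Fin n) K))
    (μ₀ : monomialSubring K S)
    (hμ₀ : ∃ d : Fin n →₀ ℕ, (∀ i, 0 < d i) ∧
      (μ₀ : MvPolynomial (Fin n) K) = monomial d 1)
    (μ : monomialSubring K S) (hμ : μ = μ₀ * ∏ i, μ' i)
    (e t : ℕ) (ht : 1 ≤ t) :
    -- `𝔞_t^[q] :_R μ^{tq} = 𝔪_A^[q] ∩ R`
    (bracketPower (nonDivisorIdeal (monomialSubring K S) (μ ^ t)) (p ^ e)).colon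
        {μ ^ (t * p ^ e)} =
      (bracketPower (varIdeal K n) (p ^ e)).comap (monomialSubring K S).val ∧
    -- the free rank of `R^{1/q}`, for graded complements
    (∀ (aq : ℕ) (M : Type*) [AddCommGroup M] [Module (monomialSubring K S) M],
      IsGradable (monomialSubring K S) M →
      NoFreeSummand (monomialSubring K S) M →
      RootDecomposition (monomialSubring K S) p e aq M →
      (aq : ℕ∞) = colength
          ((bracketPower (nonDivisorIdeal (monomialSubring K S) (μ ^ t)) (p ^ e)).colon
            {μ ^ (t * p ^ e)}) ∧
      (aq : ℕ∞) = colength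
          ((bracketPower (varIdeal K n) (p ^ e)).comap (monomialSubring K S).val)) ∧
    -- the free rank of `R^{1/q}` after localization at the homogeneous maximal ideal of `R`
    (∀ (aq : ℕ) (M : Type*) [AddCommGroup M]
      [Module (Localization.AtPrime (homMaxIdeal (monomialSubring K S))) M],
      NoFreeSummand (Localization.AtPrime (homMaxIdeal (monomialSubring K S))) M →
      LocalRootDecomposition (monomialSubring K S) p (homMaxIdeal (monomialSubring K S)) e aq M →
      (aq : ℕ∞) = colength
          ((bracketPower (nonDivisorIdeal (monomialSubring K S) (μ ^ t)) (p ^ e)).colon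
            {μ ^ (t * p ^ e)}) ∧
      (aq : ℕ∞) = colength
          ((bracketPower (varIdeal K n) (p ^ e)).comap (monomialSubring K S).val)) := by

  have hμ₀' : IsMonomial (μ₀ : MvPolynomial (Fin n) K) := hμ₀.imp fun d hd => hd.2
  obtain ⟨m, hm, H⟩ := exists_exponent_pow a ha μ' η hμ' hη hfrac μ₀ hμ₀' μ hμ t ht
  have hcolon := fun e => colon_nonDivisorIdeal p hS e (μ ^ t) m hm H
  let χ : monomialSubring K S →ₐ[K] K :=
    { (constantCoeff (R := K) (σ := Fin n)).comp (monomialSubring K S).val.toRingHom with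
      commutes' := fun c => constantCoeff_C _ c }
  have hχ : RingHom.ker χ = homMaxIdeal (monomialSubring K S) := rfl
  have hI : ∃ N, RingHom.ker χ ^ N ≤
      (bracketPower (varIdeal K n) (p ^ e)).comap (monomialSubring K S).val :=
    exists_pow_le_comap_bracketPower p e (monomialSubring K S)
  have hsplit := exists_splitting (K := K) p hS e
  have hJ : (nonDivisorIdeal (monomialSubring K S) (μ ^ t)).colon {μ ^ t} = RingHom.ker χ := by
    -- The case $q=1$ of the colon formula.
    have h0 := hcolon 0
    rwa [pow_zero, pow_one, bracketPower_one, bracketPower_one, comap_varIdeal] at h0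
  have h1 := hcolon e
  rw [← pow_mul] at h1
  refine ⟨h1, ?_, ?_⟩
  · intro aq M _ _ hgr hM hdec
    have := colength_eq_of_rootDecomposition p χ e aq _ hI hsplit _ _ hJ (hcolon e) M
      (constantCoeff_eq_zero_of_isGradable hgr hM) hdec
    rw [h1]
    exact ⟨this.symm, this.symm⟩
  · intro aq M _ _ hM hdec
    have := colength_eq_of_localRootDecomposition p χ e aq _ hI hsplit _ _ hJ (hcolon e)
      (homMaxIdeal (monomialSubring K S)) (fun _ => Iff.rfl) M hM hdec
    rw [h1]
    exact ⟨this.symm, this.symm⟩
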